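/- Let $d\ge 2$ and $\mathcal H=\mathbb C^d$ with orthonormal basis $|0\rangle,\dots,|d-1\rangle$. Let $\mathbb S=\sum_{ij}|ij\rangle\langle ji|$ be the swap operator on $\mathcal H_A\otimes\mathcal H_B$, with $\mathcal H_A=\mathcal H_B=\mathcal H$, and let $K_0=d\,\mathbb 1-\mathbb S$. Write $X\star Y=\frac12(XY+YX)$, and let $T_A$ denote the partial transpose on the first factor. For states $\rho,\sigma$ on $\mathcal H$ the unitarily invariant optimal transport cost is $$\mathcal K(\rho,\sigma)=\min_J\ \operatorname{Tr}\big[K_0\,((\rho\otimes\mathbb 1)\star J)\big],$$ where the minimum is over all operators $J$ on $\mathcal H_A\otimes\mathcal H_B$ with $J^{T_A}\ge 0$, $\operatorname{Tr}_B J=\mathbb 1$ and $\operatorname{Tr}_A[(\rho\otimes\mathbb 1)J]=\sigma$. These $J$ are exactly the Jamiołkowski matrices $J_{\mathcal E}=(\mathrm{id}\otimes\mathcal E)(\mathbb S)$ of the quantum channels (completely positive trace-preserving maps) $\mathcal E$ with $\mathcal E(\rho)=\sigma$; a channel is called optimal if its Jamiołkowski matrix attains the minimum. (a) Let $0\le\alpha\le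 1$, $|\varphi_\alpha\rangle=\alpha|0\rangle+\sqrt{1-\alpha^2}\,|1\rangle$, $\rho=|0\rangle\langle 0|$ and $\sigma=|\varphi_\alpha\rangle\langle\varphi_\alpha|$. Then $$\mathcal K(\rho,\sigma)=(1-\alpha)(d+2\alpha),$$ and the channel $X\mapsto U_\alpha XU_\alpha^*$ is optimal, where $$U_\alpha=\begin{bmatrix}\alpha&-\sqrt{1-\alpha^2}\\ \sqrt{1-\alpha^2}&\alpha\end{bmatrix}\oplus\mathbb 1_{d-2}.$$ If $\alpha>0$, it is the only optimal channel. (b) For arbitrary unit vectors $\psi,\varphi\in\mathcal H$ and $\alpha=|\langle\psi|\varphi\rangle|$ one has $\mathcal K(|\psi\rangle\langle\psi|,|\varphi\rangle\langle\varphi|)=(1-\alpha)(d+2\alpha)$. Moreover, there is a unitary $V$ with $V|\psi\rangle\langle\psi|V^*=|0\rangle\langle 0|$ and $V|\varphi\rangle\langle\varphi|V^*=|\varphi_\alpha\rangle\langle\varphi_\alpha|$ such that conjugation with $V^*U_\alpha V$ is an optimal channel. -/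

import Mathlib

open Matrix
open scoped ComplexOrder

noncomputable section

/-- Partial transpose on the first tensor factor:
`⟨ik| X^{T_A} |jl⟩ = ⟨jk| X |il⟩`. -/
def partialTransposeA {A B : Type*} (X : Matrix (A × B) (A × B) ℂ) :
    Matrix (A × B) (A × B) ℂ :=
  Matrix.of fun p q => X (q.1, p.2) (p.1, q.2)

/-- Partial trace over the second tensor factor. -/
def partialTraceB {A B : Type*} [Fintype B] (X : Matrix (A × B) (A × B) ℂ) :
    Matrix A A ℂ :=
  Matrix.of fun i j => ∑ k, X (i, k) (j, k)

/-- Partial trace over the first tensor factor. -/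
def partialTraceA {A B : Type*} [Fintype A] (X : Matrix (A × B) (A × B) ℂ) :
    Matrix B B ℂ :=
  Matrix.of fun k l => ∑ i, X (i, k) (i, l)

/-- The swap operator `S = ∑ i j, |ij⟩⟨ji|`. -/
def swapOperator (A : Type*) [DecidableEq A] : Matrix (A × A) (A × A) ℂ :=
  Matrix.of fun p q => if p.1 = q.2 ∧ p.2 = q.1 then 1 else 0

/-- The Jordan product `X ⋆ Y = (XY + YX) / 2`. -/
def jordanProduct {I : Type*} [Fintype I] (X Y : Matrix I I ℂ) : Matrix I I ℂ :=
  (1 / 2 : ℂ) • (X * Y + Y * X)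

/-- The extension `ρ ⊗ 1` of an operator on the first factor. -/
def extendA {A : Type*} (B : Type*) [DecidableEq B] (ρ : Matrix A A ℂ) :
    Matrix (A × B) (A × B) ℂ :=
  Matrix.kroneckerMap (· * ·) ρ (1 : Matrix B B ℂ)

/-- The set of Jamiołkowski matrices of quantum channels from system `A` to system `B`:
`J^{T_A} ≥ 0` and `Tr_B J = 1`. -/
def jamiolkowskiMatrices (A B : Type*) [Fintype B] [DecidableEq A] :
    Set (Matrix (A × B) (A × B) ℂ) :=
  {J | (partialTransposeA J).PosSemidef ∧ partialTraceB J = 1}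

/-- The state over time `ρ ⋆ J`, where `ρ` stands for `ρ ⊗ 1`. -/
def stateOverTime {A B : Type*} [Fintype A] [Fintype B] [DecidableEq B]
    (ρ : Matrix A A ℂ) (J : Matrix (A × B) (A × B) ℂ) : Matrix (A × B) (A × B) ℂ :=
  jordanProduct (extendA B ρ) J

/-- The set `𝒬(ρ, σ)` of states over time between `ρ` and `σ`: all `ρ ⋆ J`, where `J` is
a Jamiołkowski matrix with `Tr_A[(ρ ⊗ 1) J] = σ`. -/
def statesOverTime {A B : Type*} [Fintype A] [Fintype B] [DecidableEq A] [DecidableEq B]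
    (ρ : Matrix A A ℂ) (σ : Matrix B B ℂ) : Set (Matrix (A × B) (A × B) ℂ) :=
  {Q | ∃ J ∈ jamiolkowskiMatrices A B,
    partialTraceA (extendA B ρ * J) = σ ∧ Q = stateOverTime ρ J}

/-- The cost `Tr[K Q]`. For Hermitian `K` and `Q`, which is the case for every state over
time, this trace is real, so that taking the real part loses nothing. -/
def planCost {I : Type*} [Fintype I] (K Q : Matrix I I ℂ) : ℝ := (K * Q).trace.re

/-- The quantum transport cost with cost matrix `K`: the minimum of `Tr[K Q]` over all
states over time between `ρ` and `σ`. -/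
def transportCost {A B : Type*} [Fintype A] [Fintype B] [DecidableEq A] [DecidableEq B]
    (K : Matrix (A × B) (A × B) ℂ) (ρ : Matrix A A ℂ) (σ : Matrix B B ℂ) : ℝ :=
  sInf (planCost K '' statesOverTime ρ σ)

/-- The unitarily invariant cost matrix `K₀ = d 1 - S`, with `d` the dimension. -/
def unitaryInvariantCostMatrix (A : Type*) [Fintype A] [DecidableEq A] :
    Matrix (A × A) (A × A) ℂ :=
  (Fintype.card A : ℂ) • (1 : Matrix (A × A) (A × A) ℂ) - swapOperator A

/-- The Jamiołkowski matrix `(id ⊗ E)(S) = ∑ i j, |i⟩⟨j| ⊗ E(|j⟩⟨i|)` of a linear map. -/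
def jamiolkowski {A B : Type*} [DecidableEq A]
    (E : Matrix A A ℂ →ₗ[ℂ] Matrix B B ℂ) : Matrix (A × B) (A × B) ℂ :=
  Matrix.of fun p q => E (Matrix.single q.1 p.1 1) p.2 q.2

/-- `E` is an optimal channel for the transport problem with cost matrix `K` from `ρ`
to `σ`: it is completely positive and trace preserving (expressed through its Jamiołkowski
matrix), maps `ρ` to `σ`, and its state over time minimises the cost. -/
def IsOptimalChannel {A B : Type*} [Fintype A] [Fintype B] [DecidableEq A] [DecidableEq B]
    (K : Matrix (A × B) (A × B) ℂ) (ρ : Matrix A A ℂ) (σ : Matrix B B ℂ)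
    (E : Matrix A A ℂ →ₗ[ℂ] Matrix B B ℂ) : Prop :=
  jamiolkowski E ∈ jamiolkowskiMatrices A B ∧ E ρ = σ ∧
    ∀ Q ∈ statesOverTime ρ σ, planCost K (stateOverTime ρ (jamiolkowski E)) ≤ planCost K Q

/-- The map `X ↦ U X U*`. -/
def conjugation {A : Type*} [Fintype A] (U : Matrix A A ℂ) :
    Matrix A A ℂ →ₗ[ℂ] Matrix A A ℂ where
  toFun X := U * X * Uᴴ
  map_add' X Y := by rw [Matrix.mul_add, Matrix.add_mul]
  map_smul' c X := by simp

/-- The operator `|v⟩⟨v|`. -/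
def ketbra {A : Type*} (v : A → ℂ) : Matrix A A ℂ := Matrix.vecMulVec v (star v)

/-- The basis vector `|0⟩` of `ℂ^d = ℂ² ⊕ ℂ^(d-2)`. -/
def ketZero (d : ℕ) : Fin 2 ⊕ Fin (d - 2) → ℂ := Sum.elim ![1, 0] 0

/-- The vector `α |0⟩ + √(1 - α²) |1⟩` of `ℂ^d = ℂ² ⊕ ℂ^(d-2)`. -/
def ketAngle (d : ℕ) (α : ℝ) : Fin 2 ⊕ Fin (d - 2) → ℂ :=
  Sum.elim ![(α : ℂ), (Real.sqrt (1 - α ^ 2) : ℂ)] 0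

/-- The matrix `[[α, -√(1 - α²)], [√(1 - α²), α]] ⊕ 1_(d-2)`. -/
def rotationUnitary (d : ℕ) (α : ℝ) :
    Matrix (Fin 2 ⊕ Fin (d - 2)) (Fin 2 ⊕ Fin (d - 2)) ℂ :=
  Matrix.fromBlocks
    !![(α : ℂ), -(Real.sqrt (1 - α ^ 2) : ℂ); (Real.sqrt (1 - α ^ 2) : ℂ), (α : ℂ)] 0 0 1

end

/-!
A channel taking a pure state `ψ` to a pure state `φ` has a Kraus operator `K` with `K ψ = φ`, and
all its other Kraus operators can be taken to kill `ψ`. The cost then sees only `K`: it equals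
`d - Re (⟨φ|ψ⟩ tr K)`. Here `K` is a contraction, so the problem is to maximise `Re tr K` over the
contractions with `K ψ = φ`.

In standard position such a contraction also satisfies `K* φ = ψ`, and these two equations make each
diagonal entry of `K` equal to that of `U* K` times the corresponding diagonal entry `α` or `1` of
the rotation `U`. The diagonal entries of the contraction `U* K` have real part at most `1`, so
`Re tr K ≤ tr U`, and for `α > 0` equality forces `U* K = 1`. Then `K` is unitary, which leaves no
room for further Kraus operators.
-/

section PositiveSemidefinite

variable {m n : Type*} [Fintype n]

theorem mul_ketbra_mul_conjTranspose (V : Matrix m n ℂ) (v : n → ℂ) :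
    V * ketbra v * Vᴴ = ketbra (V *ᵥ v) := by
  rw [ketbra, ketbra, mul_vecMulVec, vecMulVec_mul, star_mulVec]

theorem conjTranspose_ketbra {m : Type*} (v : m → ℂ) : (ketbra v)ᴴ = ketbra v := by
  rw [ketbra, conjTranspose_vecMulVec, star_star]

theorem trace_ketbra (v : n → ℂ) : (ketbra v).trace = star v ⬝ᵥ v := by
  rw [ketbra, trace_vecMulVec, dotProduct_comm]

theorem ketbra_mulVec (v w : n → ℂ) : ketbra v *ᵥ w = (star v ⬝ᵥ w) • v := by
  rw [ketbra, vecMulVec_mulVec, op_smul_eq_smul]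

theorem ketbra_smul {m : Type*} {c : ℂ} (hc : ‖c‖ = 1) (v : m → ℂ) :
    ketbra (c • v) = ketbra v := by
  have hcc : c * star c = 1 := by
    rw [RCLike.star_def, Complex.mul_conj, Complex.normSq_eq_norm_sq, hc]
    norm_num
  rw [ketbra, star_smul, smul_vecMulVec, vecMulVec_smul, smul_smul, hcc, one_smul, ketbra]

theorem posSemidef_sub_ketbra_mulVec {C : Matrix n n ℂ} (hC : C.PosSemidef) {w : n → ℂ}
    (hw : star w ⬝ᵥ C *ᵥ w = 1) : (C - ketbra (C *ᵥ w)).PosSemidef := by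
  classical
  -- Compressing `C` by the oblique projection along `w` removes exactly `|Cw⟩⟨Cw|`.
  convert hC.conjTranspose_mul_mul_same (1 - vecMulVec w (star (C *ᵥ w))) using 1
  have hwC : star w ᵥ* C = star (C *ᵥ w) := by rw [star_mulVec, hC.isHermitian.eq]
  have hww : star (C *ᵥ w) ⬝ᵥ w = 1 := by rw [← hwC, ← dotProduct_mulVec, hw]
  simp only [conjTranspose_sub, conjTranspose_one, conjTranspose_vecMulVec, star_star, sub_mul,
    mul_sub, one_mul, mul_one, vecMulVec_mul, mul_vecMulVec, vecMulVec_mulVec, op_smul_eq_smul,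
    hwC, hww, one_smul, ketbra, sub_self, sub_zero]

theorem star_mulVec_dotProduct_mulVec [Fintype m] [DecidableEq n] {V : Matrix m n ℂ}
    (hV : Vᴴ * V = 1) (v w : n → ℂ) : star (V *ᵥ v) ⬝ᵥ V *ᵥ w = star v ⬝ᵥ w := by
  rw [star_mulVec, dotProduct_mulVec, vecMul_vecMul, hV, vecMul_one]

theorem conjTranspose_mulVec_eq_of_contraction [Fintype m] [DecidableEq n] {K : Matrix m n ℂ}
    (hK : (1 - Kᴴ * K).PosSemidef) {v : n → ℂ} {w : m → ℂ} (hKv : K *ᵥ v = w)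
    (hvw : star v ⬝ᵥ v = star w ⬝ᵥ w) : Kᴴ *ᵥ w = v := by
  have hquad : star v ⬝ᵥ (1 - Kᴴ * K) *ᵥ v = 0 := by
    rw [sub_mulVec, one_mulVec, ← mulVec_mulVec, hKv, dotProduct_sub, hvw, dotProduct_mulVec,
      ← star_mulVec, hKv, sub_self]
  have hker := (hK.dotProduct_mulVec_zero_iff v).1 hquad
  rw [sub_mulVec, one_mulVec, ← mulVec_mulVec, hKv] at hker
  exact (sub_eq_zero.1 hker).symm

theorem posSemidef_one_sub_conj [Fintype m] [DecidableEq m] [DecidableEq n] {K : Matrix n n ℂ}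
    {V : Matrix m n ℂ} (hK : (1 - Kᴴ * K).PosSemidef) (hV : Vᴴ * V = 1) (hV' : V * Vᴴ = 1) :
    (1 - (V * K * Vᴴ)ᴴ * (V * K * Vᴴ)).PosSemidef := by
  convert hK.mul_mul_conjTranspose_same V using 1
  rw [Matrix.mul_sub, Matrix.sub_mul, Matrix.mul_one, hV']
  congr 1
  calc (V * K * Vᴴ)ᴴ * (V * K * Vᴴ) = V * Kᴴ * (Vᴴ * V) * K * Vᴴ := by
        simp only [conjTranspose_mul, conjTranspose_conjTranspose, Matrix.mul_assoc]
    _ = V * (Kᴴ * K) * Vᴴ := by rw [hV, Matrix.mul_one]; simp only [Matrix.mul_assoc]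

theorem re_conjTranspose_mul_self_apply_nonneg {m : Type*} [Finite m] (X : Matrix n m ℂ)
    (j : m) : 0 ≤ ((Xᴴ * X) j j).re :=
  (Complex.nonneg_iff.1 (posSemidef_conjTranspose_mul_self X).diag_nonneg).1

end PositiveSemidefinite

section ContractionTrace

variable {n : Type*} [Fintype n] [DecidableEq n] {U K : Matrix n n ℂ}

theorem re_conjTranspose_sub_mul_sub_apply_le (hU : Uᴴ * U = 1) (hK : (1 - Kᴴ * K).PosSemidef)
    (j : n) : (((K - U)ᴴ * (K - U)) j j).re ≤ 2 - 2 * ((Uᴴ * K) j j).re := by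
  have hexpand : (K - U)ᴴ * (K - U) = Kᴴ * K - (Uᴴ * K)ᴴ - Uᴴ * K + 1 := by
    rw [← hU, conjTranspose_mul, conjTranspose_conjTranspose, conjTranspose_sub]
    noncomm_ring
  have hKj : 0 ≤ 1 - ((Kᴴ * K) j j).re := by
    simpa using (Complex.nonneg_iff.1 (hK.diag_nonneg (i := j))).1
  rw [hexpand, Matrix.add_apply, Matrix.sub_apply, Matrix.sub_apply, one_apply_eq,
    conjTranspose_apply, RCLike.star_def, Complex.add_re, Complex.sub_re, Complex.sub_re,
    Complex.conj_re, Complex.one_re]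
  linarith

theorem re_conjTranspose_mul_apply_le_one (hU : Uᴴ * U = 1) (hK : (1 - Kᴴ * K).PosSemidef)
    (j : n) : ((Uᴴ * K) j j).re ≤ 1 := by
  linarith [re_conjTranspose_sub_mul_sub_apply_le hU hK j,
    re_conjTranspose_mul_self_apply_nonneg (K - U) j]

theorem eq_of_one_le_re_conjTranspose_mul_apply (hU : Uᴴ * U = 1) (hK : (1 - Kᴴ * K).PosSemidef)
    (h : ∀ j, 1 ≤ ((Uᴴ * K) j j).re) : K = U := by
  have hzero : ∀ j, ((K - U)ᴴ * (K - U)) j j = 0 := fun j => by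
    refine Complex.ext (le_antisymm ?_ (re_conjTranspose_mul_self_apply_nonneg _ j)) ?_
    · rw [Complex.zero_re]
      linarith [re_conjTranspose_sub_mul_sub_apply_le hU hK j, h j]
    · exact (Complex.nonneg_iff.1
        (posSemidef_conjTranspose_mul_self (K - U)).diag_nonneg).2.symm
  exact sub_eq_zero.1 (trace_conjTranspose_mul_self_eq_zero_iff.1
    (Finset.sum_eq_zero fun j _ => hzero j))

variable {c : n → ℝ}

theorem re_trace_le_sum_of_diag_eq (hU : Uᴴ * U = 1) (hK : (1 - Kᴴ * K).PosSemidef)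
    (hc : ∀ j, 0 ≤ c j) (hdiag : ∀ j, K j j = c j * (Uᴴ * K) j j) : K.trace.re ≤ ∑ j, c j := by
  rw [trace, Complex.re_sum]
  refine Finset.sum_le_sum fun j _ => ?_
  rw [diag_apply, hdiag, Complex.re_ofReal_mul]
  exact mul_le_of_le_one_right (hc j) (re_conjTranspose_mul_apply_le_one hU hK j)

theorem eq_of_sum_le_re_trace_of_diag_eq (hU : Uᴴ * U = 1) (hK : (1 - Kᴴ * K).PosSemidef)
    (hc : ∀ j, 0 < c j) (hdiag : ∀ j, K j j = c j * (Uᴴ * K) j j)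
    (h : ∑ j, c j ≤ K.trace.re) : K = U := by
  have hle : ∀ j, c j * ((Uᴴ * K) j j).re ≤ c j := fun j =>
    mul_le_of_le_one_right (hc j).le (re_conjTranspose_mul_apply_le_one hU hK j)
  have htrace : K.trace.re = ∑ j, c j * ((Uᴴ * K) j j).re := by
    rw [trace, Complex.re_sum]
    exact Finset.sum_congr rfl fun j _ => by rw [diag_apply, hdiag, Complex.re_ofReal_mul]
  have heq : ∀ j ∈ Finset.univ, c j * ((Uᴴ * K) j j).re = c j :=
    (Finset.sum_eq_sum_iff_of_le fun j _ => hle j).1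
      ((Finset.sum_le_sum fun j _ => hle j).antisymm (htrace ▸ h))
  refine eq_of_one_le_re_conjTranspose_mul_apply hU hK fun j => ?_
  exact ((mul_eq_left₀ (hc j).ne').1 (heq j (Finset.mem_univ j))).ge

end ContractionTrace

section PartialTrace

variable {A B : Type*}

theorem partialTransposeA_injective :
    Function.Injective (partialTransposeA (A := A) (B := B)) := fun _ _ h =>
  Matrix.ext fun p q => congrFun (congrFun h (q.1, p.2)) (p.1, q.2)

theorem isHermitian_of_isHermitian_partialTransposeA {J : Matrix (A × B) (A × B) ℂ}
    (hJ : (partialTransposeA J).IsHermitian) : J.IsHermitian :=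
  Matrix.ext fun p q => hJ.apply (q.1, p.2) (p.1, q.2)

theorem partialTraceB_sub [Fintype B] (X Y : Matrix (A × B) (A × B) ℂ) :
    partialTraceB (X - Y) = partialTraceB X - partialTraceB Y := by
  ext i j
  simp [partialTraceB]

theorem partialTraceB_partialTransposeA [Fintype B] (X : Matrix (A × B) (A × B) ℂ) :
    partialTraceB (partialTransposeA X) = (partialTraceB X)ᵀ := rfl

theorem partialTraceB_ketbra_vec [Fintype B] (K : Matrix B A ℂ) :
    partialTraceB (ketbra (vec K)) = (Kᴴ * K)ᵀ := by
  ext i j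
  simp [partialTraceB, ketbra, vecMulVec_apply, vec, mul_apply, mul_comm]

theorem posSemidef_partialTraceB [Fintype B] {X : Matrix (A × B) (A × B) ℂ}
    (hX : X.PosSemidef) : (partialTraceB X).PosSemidef := by
  have hsum : partialTraceB X = ∑ k, X.submatrix (·, k) (·, k) := by
    ext i j
    simp [partialTraceB, Matrix.sum_apply]
  exact hsum ▸ posSemidef_sum _ fun k _ => hX.submatrix _

variable [Fintype A] [Fintype B]

theorem trace_partialTraceB (X : Matrix (A × B) (A × B) ℂ) :
    (partialTraceB X).trace = X.trace := by
  simp [partialTraceB, trace, Fintype.sum_prod_type]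

variable [DecidableEq B]

theorem partialTraceB_extendA_mul (ρ : Matrix A A ℂ) (J : Matrix (A × B) (A × B) ℂ) :
    partialTraceB (extendA B ρ * J) = ρ * partialTraceB J := by
  ext i j
  simp only [partialTraceB, of_apply, mul_apply, extendA, kroneckerMap_apply, one_apply,
    Fintype.sum_prod_type, mul_ite, mul_one, mul_zero, ite_mul, zero_mul, Finset.sum_ite_eq,
    Finset.mem_univ, if_true, Finset.mul_sum]
  exact Finset.sum_comm

theorem dotProduct_partialTraceA_extendA_ketbra_mul_mulVec (ψ : A → ℂ)
    (J : Matrix (A × B) (A × B) ℂ) (y y' : B → ℂ) :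
    star y ⬝ᵥ partialTraceA (extendA B (ketbra ψ) * J) *ᵥ y' =
      star (vec (vecMulVec y (star ψ))) ⬝ᵥ
        partialTransposeA J *ᵥ vec (vecMulVec y' (star ψ)) := by
  simp only [dotProduct, mulVec, partialTraceA, of_apply, mul_apply, extendA, kroneckerMap_apply,
    one_apply, Fintype.sum_prod_type, mul_ite, mul_one, mul_zero, ite_mul, zero_mul,
    Finset.sum_ite_eq, Finset.mem_univ, if_true, Finset.mul_sum, Finset.sum_mul, ketbra, vec,
    vecMulVec_apply, Pi.star_apply, partialTransposeA, star_mul', star_star]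
  refine (Finset.sum_congr rfl fun k _ => Finset.sum_comm.trans
    (Finset.sum_congr rfl fun i _ => Finset.sum_comm)).trans (Finset.sum_comm.trans ?_)
  exact Finset.sum_congr rfl fun i _ => Finset.sum_congr rfl fun k _ =>
    Finset.sum_congr rfl fun j _ => Finset.sum_congr rfl fun l _ => by ring

end PartialTrace

section DominantKraus

variable {A B : Type*} [Fintype B] {J : Matrix (A × B) (A × B) ℂ}

/- Every Kraus operator of the channel maps `ψ` into the line of `φ`, so after a unitary mixing all
but one of them kill `ψ`. The survivor `K` is read off from the Choi matrix `partialTransposeA J`,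
which sends `vec |φ⟩⟨ψ|` to `vec K`. -/
theorem exists_dominant_kraus [Fintype A] [DecidableEq B] {ψ : A → ℂ} {φ : B → ℂ}
    (hC : (partialTransposeA J).PosSemidef) (hφ : star φ ⬝ᵥ φ = 1)
    (hσ : partialTraceA (extendA B (ketbra ψ) * J) = ketbra φ) :
    ∃ K : Matrix B A ℂ, K *ᵥ ψ = φ ∧ (partialTransposeA J - ketbra (vec K)).PosSemidef ∧
      ∀ y, partialTransposeA J *ᵥ vec (vecMulVec y (star ψ)) = (star φ ⬝ᵥ y) • vec K := by
  have hquad : ∀ y y', star (vec (vecMulVec y (star ψ))) ⬝ᵥ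
      partialTransposeA J *ᵥ vec (vecMulVec y' (star ψ)) = (star φ ⬝ᵥ y') * (star y ⬝ᵥ φ) :=
    fun y y' => by
      rw [← dotProduct_partialTraceA_extendA_ketbra_mul_mulVec, hσ, ketbra_mulVec,
        dotProduct_smul, smul_eq_mul]
  obtain ⟨K, hK⟩ : ∃ K : Matrix B A ℂ,
      vec K = partialTransposeA J *ᵥ vec (vecMulVec φ (star ψ)) := vec_bijective.surjective _
  have hinner : ∀ y, star (vec (vecMulVec y (star ψ))) ⬝ᵥ vec K = star y ⬝ᵥ φ := fun y => by
    rw [hK, hquad, hφ, one_mul]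
  have hR : (partialTransposeA J - ketbra (vec K)).PosSemidef := by
    rw [hK]
    exact posSemidef_sub_ketbra_mulVec hC (by rw [hquad, hφ, one_mul])
  refine ⟨K, ?_, hR, fun y => ?_⟩
  · refine dotProduct_eq _ _ fun y => ?_
    have h := hinner (star y)
    rw [star_star, star_vec_dotProduct_vec, conjTranspose_vecMulVec, star_star, star_star,
      trace_mul_comm, mul_vecMulVec, trace_vecMulVec] at h
    rw [h, dotProduct_comm]
  · have hconj : star (vec K) ⬝ᵥ vec (vecMulVec y (star ψ)) = star φ ⬝ᵥ y := by
      rw [← star_star (star φ ⬝ᵥ y), ← star_dotProduct, ← hinner, star_dotProduct]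
    have hker : (partialTransposeA J - ketbra (vec K)) *ᵥ vec (vecMulVec y (star ψ)) = 0 := by
      refine (hR.dotProduct_mulVec_zero_iff _).1 ?_
      rw [sub_mulVec, dotProduct_sub, hquad, ketbra_mulVec, dotProduct_smul, hconj, hinner,
        smul_eq_mul, sub_self]
    rwa [sub_mulVec, sub_eq_zero, ketbra_mulVec, hconj] at hker

variable {K : Matrix B A ℂ}

theorem partialTraceB_sub_ketbra_vec [DecidableEq A] (hJ : partialTraceB J = 1) :
    partialTraceB (partialTransposeA J - ketbra (vec K)) = (1 - Kᴴ * K)ᵀ := by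
  rw [partialTraceB_sub, partialTraceB_partialTransposeA, hJ, partialTraceB_ketbra_vec,
    transpose_sub]

theorem posSemidef_one_sub_conjTranspose_mul_self [Finite A] [DecidableEq A]
    (hJ : partialTraceB J = 1)
    (hK : (partialTransposeA J - ketbra (vec K)).PosSemidef) : (1 - Kᴴ * K).PosSemidef :=
  posSemidef_transpose_iff.1 (partialTraceB_sub_ketbra_vec hJ ▸ posSemidef_partialTraceB hK)

theorem partialTransposeA_eq_ketbra_vec [Finite A] [DecidableEq A]
    (hJ : partialTraceB J = 1)
    (hK : (partialTransposeA J - ketbra (vec K)).PosSemidef) (hKK : Kᴴ * K = 1) :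
    partialTransposeA J = ketbra (vec K) := by
  have := Fintype.ofFinite A
  refine sub_eq_zero.1 (hK.trace_eq_zero_iff.1 ?_)
  rw [← trace_partialTraceB, partialTraceB_sub_ketbra_vec hJ, hKK, sub_self, transpose_zero,
    trace_zero]

end DominantKraus

section Jamiolkowski

variable {A B : Type*} [DecidableEq A]

theorem partialTraceA_extendA_mul_jamiolkowski [Fintype A] [Fintype B] [DecidableEq B]
    (ρ : Matrix A A ℂ) (E : Matrix A A ℂ →ₗ[ℂ] Matrix B B ℂ) :
    partialTraceA (extendA B ρ * jamiolkowski E) = E ρ := by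
  ext k l
  conv_rhs => rw [matrix_eq_sum_single ρ]
  simp only [map_sum, Matrix.sum_apply, partialTraceA, of_apply, Matrix.mul_apply,
    Fintype.sum_prod_type, extendA, kroneckerMap_apply, Matrix.one_apply, jamiolkowski, mul_ite,
    ite_mul, mul_one, mul_zero, zero_mul, Finset.sum_ite_eq, Finset.mem_univ, if_true]
  refine Finset.sum_congr rfl fun i _ => Finset.sum_congr rfl fun j _ => ?_
  rw [← mul_one (ρ i j), ← smul_eq_mul (ρ i j) 1, ← smul_single, map_smul, Matrix.smul_apply,
    smul_eq_mul, smul_eq_mul, mul_one]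

theorem jamiolkowski_injective [Finite A] [Finite B] :
    Function.Injective (jamiolkowski : (Matrix A A ℂ →ₗ[ℂ] Matrix B B ℂ) → _) := by
  classical
  have := Fintype.ofFinite A
  have := Fintype.ofFinite B
  intro E F h
  refine LinearMap.ext fun ρ => ?_
  rw [← partialTraceA_extendA_mul_jamiolkowski ρ E, h, partialTraceA_extendA_mul_jamiolkowski]

variable [Fintype A]

theorem IsOptimalChannel.transportCost_eq [Fintype B] [DecidableEq B]
    {K : Matrix (A × B) (A × B) ℂ} {ρ : Matrix A A ℂ}
    {σ : Matrix B B ℂ} {E : Matrix A A ℂ →ₗ[ℂ] Matrix B B ℂ} (hE : IsOptimalChannel K ρ σ E) :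
    transportCost K ρ σ = planCost K (stateOverTime ρ (jamiolkowski E)) := by
  refine IsLeast.csInf_eq ⟨⟨_, ⟨_, hE.1, ?_, rfl⟩, rfl⟩, ?_⟩
  · rw [partialTraceA_extendA_mul_jamiolkowski, hE.2.1]
  · rintro _ ⟨Q, hQ, rfl⟩
    exact hE.2.2 Q hQ

theorem partialTransposeA_jamiolkowski_conjugation (U : Matrix A A ℂ) :
    partialTransposeA (jamiolkowski (conjugation U)) = ketbra (vec U) := by
  ext ⟨i, k⟩ ⟨j, l⟩
  simp [partialTransposeA, jamiolkowski, conjugation, Matrix.mul_apply, Matrix.single_apply,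
    ketbra, vec, vecMulVec_apply, ite_and]

theorem jamiolkowski_conjugation_mem {U : Matrix A A ℂ} (hU : Uᴴ * U = 1) :
    jamiolkowski (conjugation U) ∈ jamiolkowskiMatrices A A := by
  refine ⟨?_, transpose_injective ?_⟩
  · rw [partialTransposeA_jamiolkowski_conjugation]
    exact posSemidef_vecMulVec_self_star _
  · rw [← partialTraceB_partialTransposeA, partialTransposeA_jamiolkowski_conjugation,
      partialTraceB_ketbra_vec, hU]

end Jamiolkowski

section Cost

variable {n : Type*} [Fintype n] [DecidableEq n]

theorem isHermitian_unitaryInvariantCostMatrix : (unitaryInvariantCostMatrix n).IsHermitian := by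
  ext p q
  simp only [unitaryInvariantCostMatrix, swapOperator, conjTranspose_apply, Matrix.sub_apply,
    Matrix.smul_apply, Matrix.one_apply, of_apply, star_sub, smul_eq_mul, star_mul', apply_ite star,
    star_one, star_zero, star_natCast, eq_comm (a := q), eq_comm (a := q.1), eq_comm (a := q.2),
    and_comm]

theorem planCost_stateOverTime {A B : Type*} [Fintype A] [Fintype B] [DecidableEq B]
    {K J : Matrix (A × B) (A × B) ℂ} {ρ : Matrix A A ℂ} (hK : K.IsHermitian) (hρ : ρ.IsHermitian)
    (hJ : J.IsHermitian) :
    planCost K (stateOverTime ρ J) = (K * (extendA B ρ * J)).trace.re := by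
  have hX : (extendA B ρ).IsHermitian := by
    rw [IsHermitian, extendA, conjTranspose_kronecker, conjTranspose_one, hρ.eq]
  have hsym : (K * (J * extendA B ρ)).trace = star (K * (extendA B ρ * J)).trace := by
    rw [← trace_conjTranspose, conjTranspose_mul, conjTranspose_mul, hX.eq, hJ.eq, hK.eq,
      trace_mul_comm]
  rw [planCost, stateOverTime, jordanProduct, Matrix.mul_smul, Matrix.mul_add, trace_smul,
    trace_add, hsym, RCLike.star_def, Complex.add_conj, smul_eq_mul, Complex.ofReal_mul,
    ← mul_assoc]
  norm_num

theorem trace_swapOperator_mul_extendA_mul (ρ : Matrix n n ℂ) (J : Matrix (n × n) (n × n) ℂ) :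
    (swapOperator n * (extendA n ρ * J)).trace =
      vec 1 ⬝ᵥ partialTransposeA J *ᵥ vec ρ := by
  simp only [trace, diag_apply, mul_apply, swapOperator, extendA, dotProduct, mulVec, vec,
    of_apply, kroneckerMap_apply, one_apply, partialTransposeA, Fintype.sum_prod_type, ite_and,
    ite_mul, one_mul, zero_mul, Finset.sum_ite_eq, Finset.sum_ite_eq', Finset.mem_univ, if_true,
    mul_comm (ρ _ _)]
  exact Finset.sum_congr rfl fun i _ => Finset.sum_comm

theorem planCost_unitaryInvariantCostMatrix {ρ : Matrix n n ℂ} (hρ : ρ.IsHermitian)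
    {J : Matrix (n × n) (n × n) ℂ} (hJ : J ∈ jamiolkowskiMatrices n n) :
    planCost (unitaryInvariantCostMatrix n) (stateOverTime ρ J) =
      Fintype.card n * ρ.trace.re - (vec 1 ⬝ᵥ partialTransposeA J *ᵥ vec ρ).re := by
  have hJh := isHermitian_of_isHermitian_partialTransposeA hJ.1.isHermitian
  have htrace : (extendA n ρ * J).trace = ρ.trace := by
    rw [← trace_partialTraceB, partialTraceB_extendA_mul, hJ.2, mul_one]
  rw [planCost_stateOverTime isHermitian_unitaryInvariantCostMatrix hρ hJh,
    unitaryInvariantCostMatrix, sub_mul, trace_sub, trace_swapOperator_mul_extendA_mul, smul_mul,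
    one_mul, trace_smul, htrace, smul_eq_mul, Complex.sub_re, ← Complex.ofReal_natCast,
    Complex.re_ofReal_mul]

variable {ψ φ : n → ℂ} {J : Matrix (n × n) (n × n) ℂ}

theorem planCost_stateOverTime_ketbra (hψ : star ψ ⬝ᵥ ψ = 1) (hJ : J ∈ jamiolkowskiMatrices n n)
    {c : ℂ} {K : Matrix n n ℂ} (hK : partialTransposeA J *ᵥ vec (ketbra ψ) = c • vec K) :
    planCost (unitaryInvariantCostMatrix n) (stateOverTime (ketbra ψ) J) =
      Fintype.card n - (c * K.trace).re := by
  have htrace : vec 1 ⬝ᵥ vec K = K.trace := by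
    rw [vec_dotProduct_vec, transpose_one, one_mul]
  rw [planCost_unitaryInvariantCostMatrix (conjTranspose_ketbra ψ) hJ, trace_ketbra, hψ, hK,
    dotProduct_smul, smul_eq_mul, htrace, Complex.one_re, mul_one]

theorem planCost_jamiolkowski_conjugation {W : Matrix n n ℂ} (hW : Wᴴ * W = 1)
    (hψ : star ψ ⬝ᵥ ψ = 1) (hWψ : W *ᵥ ψ = φ) :
    planCost (unitaryInvariantCostMatrix n)
        (stateOverTime (ketbra ψ) (jamiolkowski (conjugation W))) =
      Fintype.card n - ((star φ ⬝ᵥ ψ) * W.trace).re := by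
  refine planCost_stateOverTime_ketbra hψ (jamiolkowski_conjugation_mem hW) ?_
  rw [partialTransposeA_jamiolkowski_conjugation, ketbra_mulVec, star_vec_dotProduct_vec, ketbra,
    mul_vecMulVec, trace_vecMulVec, dotProduct_comm, dotProduct_mulVec, ← star_mulVec, hWψ]

theorem exists_contraction_planCost_eq (hψ : star ψ ⬝ᵥ ψ = 1) (hφ : star φ ⬝ᵥ φ = 1)
    (hJ : J ∈ jamiolkowskiMatrices n n)
    (hσ : partialTraceA (extendA n (ketbra ψ) * J) = ketbra φ) :
    ∃ K : Matrix n n ℂ, (1 - Kᴴ * K).PosSemidef ∧ K *ᵥ ψ = φ ∧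
      planCost (unitaryInvariantCostMatrix n) (stateOverTime (ketbra ψ) J) =
        Fintype.card n - ((star φ ⬝ᵥ ψ) * K.trace).re ∧
      (Kᴴ * K = 1 → J = jamiolkowski (conjugation K)) := by
  obtain ⟨K, hKψ, hK, hJK⟩ := exists_dominant_kraus hJ.1 hφ hσ
  refine ⟨K, posSemidef_one_sub_conjTranspose_mul_self hJ.2 hK, hKψ,
    planCost_stateOverTime_ketbra hψ hJ (hJK ψ), fun hKK => partialTransposeA_injective ?_⟩
  rw [partialTransposeA_eq_ketbra_vec hJ.2 hK hKK, partialTransposeA_jamiolkowski_conjugation]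

end Cost

section Rotation

variable {d : ℕ} {α : ℝ}

theorem ketZero_eq_single (d : ℕ) : ketZero d = Pi.single (Sum.inl 0) 1 := by
  ext (i | i)
  · fin_cases i <;> simp [ketZero]
  · simp [ketZero]

theorem ketAngle_eq_add (d : ℕ) (α : ℝ) :
    ketAngle d α = (α : ℂ) • Pi.single (Sum.inl 0) 1 +
      (√(1 - α ^ 2) : ℂ) • Pi.single (Sum.inl 1) 1 := by
  ext (i | i)
  · fin_cases i <;> simp [ketAngle]
  · simp [ketAngle]

theorem rotationUnitary_mulVec_ketZero (d : ℕ) (α : ℝ) :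
    rotationUnitary d α *ᵥ ketZero d = ketAngle d α := by
  rw [ketZero_eq_single]
  ext (i | i)
  · fin_cases i <;> simp [rotationUnitary, ketAngle]
  · simp [rotationUnitary, ketAngle]

theorem ofReal_sqrt_one_sub_sq_sq (hα0 : 0 ≤ α) (hα1 : α ≤ 1) :
    (√(1 - α ^ 2) : ℂ) ^ 2 = 1 - (α : ℂ) ^ 2 := by
  exact_mod_cast Real.sq_sqrt (show 0 ≤ 1 - α ^ 2 by nlinarith)

theorem conjTranspose_rotationUnitary_mul (d : ℕ) (hα0 : 0 ≤ α) (hα1 : α ≤ 1) :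
    (rotationUnitary d α)ᴴ * rotationUnitary d α = 1 := by
  have hs := ofReal_sqrt_one_sub_sq_sq hα0 hα1
  rw [rotationUnitary, fromBlocks_conjTranspose, fromBlocks_multiply, ← fromBlocks_one]
  congr 1
  · ext i j
    fin_cases i <;> fin_cases j <;>
      simp [Matrix.mul_apply, Fin.sum_univ_two, ← sq, hs, mul_comm]
  · simp
  · simp
  · simp

theorem re_trace_rotationUnitary (d : ℕ) (α : ℝ) :
    (rotationUnitary d α).trace.re = 2 * α + (d - 2 : ℕ) := by
  simp [rotationUnitary, trace, Fintype.sum_sum_type, two_mul]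

theorem card_sub_mul_re_trace_rotationUnitary (hd : 2 ≤ d) (α : ℝ) :
    Fintype.card (Fin 2 ⊕ Fin (d - 2)) - α * (rotationUnitary d α).trace.re =
      (1 - α) * (d + 2 * α) := by
  rw [re_trace_rotationUnitary, Fintype.card_sum, Fintype.card_fin, Fintype.card_fin,
    Nat.add_sub_cancel' hd, Nat.cast_sub hd, Nat.cast_ofNat]
  ring

variable {K : Matrix (Fin 2 ⊕ Fin (d - 2)) (Fin 2 ⊕ Fin (d - 2)) ℂ}

theorem diag_eq_mul_conjTranspose_rotationUnitary_mul (hα0 : 0 ≤ α) (hα1 : α ≤ 1)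
    (hK : (1 - Kᴴ * K).PosSemidef) (hKα : K *ᵥ ketZero d = ketAngle d α)
    (j : Fin 2 ⊕ Fin (d - 2)) :
    K j j = ((rotationUnitary d α j j).re : ℂ) * ((rotationUnitary d α)ᴴ * K) j j := by
  have hs := ofReal_sqrt_one_sub_sq_sq hα0 hα1
  have hcol : ∀ i, K i (Sum.inl 0) = ketAngle d α i := fun i => by
    rw [← hKα, ketZero_eq_single, mulVec_single_one, col_apply]
  have hadj : Kᴴ *ᵥ ketAngle d α = ketZero d := by
    refine conjTranspose_mulVec_eq_of_contraction hK hKα ?_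
    rw [← rotationUnitary_mulVec_ketZero,
      star_mulVec_dotProduct_mulVec (conjTranspose_rotationUnitary_mul d hα0 hα1)]
  have hrow : K (Sum.inl 0) (Sum.inl 1) * α + K (Sum.inl 1) (Sum.inl 1) * √(1 - α ^ 2) = 0 := by
    simpa [mulVec, dotProduct, ketAngle, ketZero] using
      congrArg star (congrFun hadj (Sum.inl 1))
  match j with
  | Sum.inl 0 =>
    have hUK : ((rotationUnitary d α)ᴴ * K) (Sum.inl 0) (Sum.inl 0) =
        α * α + √(1 - α ^ 2) * √(1 - α ^ 2) := by
      simp [rotationUnitary, mul_apply, hcol, ketAngle]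
    rw [hUK, ← sq (√(1 - α ^ 2) : ℂ), hs, hcol]
    simp [rotationUnitary, ketAngle, sq]
  | Sum.inl 1 =>
    have hUK : ((rotationUnitary d α)ᴴ * K) (Sum.inl 1) (Sum.inl 1) =
        -(√(1 - α ^ 2) * K (Sum.inl 0) (Sum.inl 1)) + α * K (Sum.inl 1) (Sum.inl 1) := by
      simp [rotationUnitary, mul_apply]
    have hα : (rotationUnitary d α (Sum.inl 1) (Sum.inl 1)).re = α := by simp [rotationUnitary]
    rw [hUK, hα]
    linear_combination √(1 - α ^ 2) * hrow - K (Sum.inl 1) (Sum.inl 1) * hs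
  | Sum.inr j => simp [rotationUnitary, mul_apply, one_apply]

theorem sum_re_diag_rotationUnitary (d : ℕ) (α : ℝ) :
    ∑ j, (rotationUnitary d α j j).re = (rotationUnitary d α).trace.re :=
  (Complex.re_sum _ _).symm

theorem re_trace_le_re_trace_rotationUnitary (hα0 : 0 ≤ α) (hα1 : α ≤ 1)
    (hK : (1 - Kᴴ * K).PosSemidef) (hKα : K *ᵥ ketZero d = ketAngle d α) :
    K.trace.re ≤ (rotationUnitary d α).trace.re := by
  rw [← sum_re_diag_rotationUnitary]
  refine re_trace_le_sum_of_diag_eq (conjTranspose_rotationUnitary_mul d hα0 hα1) hK ?_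
    (diag_eq_mul_conjTranspose_rotationUnitary_mul hα0 hα1 hK hKα)
  rintro (j | j)
  · fin_cases j <;> simpa [rotationUnitary] using hα0
  · simp [rotationUnitary]

theorem eq_rotationUnitary_of_le_re_trace (hα0 : 0 < α) (hα1 : α ≤ 1)
    (hK : (1 - Kᴴ * K).PosSemidef) (hKα : K *ᵥ ketZero d = ketAngle d α)
    (h : (rotationUnitary d α).trace.re ≤ K.trace.re) : K = rotationUnitary d α := by
  rw [← sum_re_diag_rotationUnitary] at h
  refine eq_of_sum_le_re_trace_of_diag_eq (conjTranspose_rotationUnitary_mul d hα0.le hα1) hK ?_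
    (diag_eq_mul_conjTranspose_rotationUnitary_mul hα0.le hα1 hK hKα) h
  rintro (j | j)
  · fin_cases j <;> simpa [rotationUnitary] using hα0
  · simp [rotationUnitary]

end Rotation

section StandardPosition

/-- The unitary `V` moves `ψ` and `φ` to `|0⟩` and `α|0⟩ + √(1 - α²)|1⟩`. The overlap `⟨ψ|φ⟩` of
such vectors is the nonnegative real `α`; pure states can be represented by such vectors after
a change of phase. -/
structure StandardPosition (d : ℕ) (α : ℝ) (ψ φ : Fin 2 ⊕ Fin (d - 2) → ℂ)
    (V : Matrix (Fin 2 ⊕ Fin (d - 2)) (Fin 2 ⊕ Fin (d - 2)) ℂ) : Prop where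
  nonneg : 0 ≤ α
  le_one : α ≤ 1
  mem_unitaryGroup : V ∈ unitaryGroup (Fin 2 ⊕ Fin (d - 2)) ℂ
  mulVec_left : V *ᵥ ψ = ketZero d
  mulVec_right : V *ᵥ φ = ketAngle d α

namespace StandardPosition

variable {d : ℕ} {α : ℝ} {ψ φ : Fin 2 ⊕ Fin (d - 2) → ℂ}
  {V : Matrix (Fin 2 ⊕ Fin (d - 2)) (Fin 2 ⊕ Fin (d - 2)) ℂ}

theorem mul_conjTranspose (h : StandardPosition d α ψ φ V) : V * Vᴴ = 1 :=
  mem_unitaryGroup_iff.1 h.mem_unitaryGroup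

theorem conjTranspose_mul (h : StandardPosition d α ψ φ V) : Vᴴ * V = 1 :=
  mem_unitaryGroup_iff'.1 h.mem_unitaryGroup

theorem rotation_mulVec (h : StandardPosition d α ψ φ V) :
    (Vᴴ * rotationUnitary d α * V) *ᵥ ψ = φ := by
  rw [← mulVec_mulVec, h.mulVec_left, ← mulVec_mulVec, rotationUnitary_mulVec_ketZero,
    ← h.mulVec_right, mulVec_mulVec, h.conjTranspose_mul, one_mulVec]

theorem conjTranspose_rotation_mul (h : StandardPosition d α ψ φ V) :
    (Vᴴ * rotationUnitary d α * V)ᴴ * (Vᴴ * rotationUnitary d α * V) = 1 := by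
  calc (Vᴴ * rotationUnitary d α * V)ᴴ * (Vᴴ * rotationUnitary d α * V)
      = Vᴴ * (rotationUnitary d α)ᴴ * (V * Vᴴ) * rotationUnitary d α * V := by
        simp only [Matrix.conjTranspose_mul, conjTranspose_conjTranspose, Matrix.mul_assoc]
    _ = Vᴴ * ((rotationUnitary d α)ᴴ * rotationUnitary d α) * V := by
        rw [h.mul_conjTranspose, mul_one]
        simp only [Matrix.mul_assoc]
    _ = 1 := by
        rw [conjTranspose_rotationUnitary_mul d h.nonneg h.le_one, mul_one, h.conjTranspose_mul]

theorem trace_rotation (h : StandardPosition d α ψ φ V) :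
    (Vᴴ * rotationUnitary d α * V).trace = (rotationUnitary d α).trace := by
  rw [trace_mul_cycle, h.mul_conjTranspose, one_mul]

theorem star_dotProduct_self_left (h : StandardPosition d α ψ φ V) : star ψ ⬝ᵥ ψ = 1 := by
  rw [← star_mulVec_dotProduct_mulVec h.conjTranspose_mul, h.mulVec_left, ketZero_eq_single]
  simp

theorem star_dotProduct_self_right (h : StandardPosition d α ψ φ V) : star φ ⬝ᵥ φ = 1 := by
  rw [← h.rotation_mulVec, star_mulVec_dotProduct_mulVec h.conjTranspose_rotation_mul,
    h.star_dotProduct_self_left]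

theorem star_dotProduct_right_left (h : StandardPosition d α ψ φ V) : star φ ⬝ᵥ ψ = α := by
  rw [← star_mulVec_dotProduct_mulVec h.conjTranspose_mul, h.mulVec_left,
    h.mulVec_right, ketZero_eq_single]
  simp [ketAngle]

variable {K : Matrix (Fin 2 ⊕ Fin (d - 2)) (Fin 2 ⊕ Fin (d - 2)) ℂ}

theorem conj_mulVec_ketZero (h : StandardPosition d α ψ φ V) (hKψ : K *ᵥ ψ = φ) :
    (V * K * Vᴴ) *ᵥ ketZero d = ketAngle d α := by
  rw [← h.mulVec_left, mulVec_mulVec, Matrix.mul_assoc _ Vᴴ, h.conjTranspose_mul, mul_one,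
    ← mulVec_mulVec, hKψ, h.mulVec_right]

theorem re_trace_le (h : StandardPosition d α ψ φ V) (hK : (1 - Kᴴ * K).PosSemidef)
    (hKψ : K *ᵥ ψ = φ) : K.trace.re ≤ (rotationUnitary d α).trace.re := by
  have hle := re_trace_le_re_trace_rotationUnitary h.nonneg h.le_one
    (posSemidef_one_sub_conj hK h.conjTranspose_mul h.mul_conjTranspose)
    (h.conj_mulVec_ketZero hKψ)
  rwa [trace_mul_cycle, h.conjTranspose_mul, one_mul] at hle

theorem eq_rotation_of_le_re_trace (h : StandardPosition d α ψ φ V) (hα : 0 < α)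
    (hK : (1 - Kᴴ * K).PosSemidef) (hKψ : K *ᵥ ψ = φ)
    (hle : (rotationUnitary d α).trace.re ≤ K.trace.re) : K = Vᴴ * rotationUnitary d α * V := by
  have heq : V * K * Vᴴ = rotationUnitary d α := by
    refine eq_rotationUnitary_of_le_re_trace hα h.le_one
      (posSemidef_one_sub_conj hK h.conjTranspose_mul h.mul_conjTranspose)
      (h.conj_mulVec_ketZero hKψ) ?_
    rwa [trace_mul_cycle, h.conjTranspose_mul, one_mul]
  calc K = (Vᴴ * V) * K * (Vᴴ * V) := by rw [h.conjTranspose_mul, one_mul, mul_one]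
    _ = Vᴴ * (V * K * Vᴴ) * V := by simp only [Matrix.mul_assoc]
    _ = Vᴴ * rotationUnitary d α * V := by rw [heq]

variable {J : Matrix ((Fin 2 ⊕ Fin (d - 2)) × (Fin 2 ⊕ Fin (d - 2)))
  ((Fin 2 ⊕ Fin (d - 2)) × (Fin 2 ⊕ Fin (d - 2))) ℂ}

theorem planCost_rotation (h : StandardPosition d α ψ φ V) (hd : 2 ≤ d) :
    planCost (unitaryInvariantCostMatrix _) (stateOverTime (ketbra ψ)
      (jamiolkowski (conjugation (Vᴴ * rotationUnitary d α * V)))) = (1 - α) * (d + 2 * α) := by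
  rw [planCost_jamiolkowski_conjugation h.conjTranspose_rotation_mul h.star_dotProduct_self_left
    h.rotation_mulVec, h.star_dotProduct_right_left, h.trace_rotation, Complex.re_ofReal_mul,
    card_sub_mul_re_trace_rotationUnitary hd]

theorem le_planCost (h : StandardPosition d α ψ φ V) (hd : 2 ≤ d)
    (hJ : J ∈ jamiolkowskiMatrices _ _)
    (hσ : partialTraceA (extendA _ (ketbra ψ) * J) = ketbra φ) :
    (1 - α) * (d + 2 * α) ≤
      planCost (unitaryInvariantCostMatrix _) (stateOverTime (ketbra ψ) J) := by
  obtain ⟨K, hK, hKψ, hcost, -⟩ :=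
    exists_contraction_planCost_eq h.star_dotProduct_self_left h.star_dotProduct_self_right hJ hσ
  rw [hcost, h.star_dotProduct_right_left, Complex.re_ofReal_mul,
    ← card_sub_mul_re_trace_rotationUnitary hd]
  exact sub_le_sub_left (mul_le_mul_of_nonneg_left (h.re_trace_le hK hKψ) h.nonneg) _

theorem eq_jamiolkowski_of_planCost_le (h : StandardPosition d α ψ φ V) (hd : 2 ≤ d) (hα : 0 < α)
    (hJ : J ∈ jamiolkowskiMatrices _ _)
    (hσ : partialTraceA (extendA _ (ketbra ψ) * J) = ketbra φ)
    (hle : planCost (unitaryInvariantCostMatrix _) (stateOverTime (ketbra ψ) J) ≤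
      (1 - α) * (d + 2 * α)) :
    J = jamiolkowski (conjugation (Vᴴ * rotationUnitary d α * V)) := by
  obtain ⟨K, hK, hKψ, hcost, hJK⟩ :=
    exists_contraction_planCost_eq h.star_dotProduct_self_left h.star_dotProduct_self_right hJ hσ
  rw [hcost, h.star_dotProduct_right_left, Complex.re_ofReal_mul,
    ← card_sub_mul_re_trace_rotationUnitary hd, sub_le_sub_iff_left, mul_le_mul_iff_right₀ hα]
    at hle
  obtain rfl := h.eq_rotation_of_le_re_trace hα hK hKψ hle
  exact hJK h.conjTranspose_rotation_mul

theorem isOptimalChannel (h : StandardPosition d α ψ φ V) (hd : 2 ≤ d) :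
    IsOptimalChannel (unitaryInvariantCostMatrix _) (ketbra ψ) (ketbra φ)
      (conjugation (Vᴴ * rotationUnitary d α * V)) := by
  refine ⟨jamiolkowski_conjugation_mem h.conjTranspose_rotation_mul, ?_, ?_⟩
  · exact (mul_ketbra_mul_conjTranspose _ ψ).trans (congrArg ketbra h.rotation_mulVec)
  · rintro _ ⟨J, hJ, hσ, rfl⟩
    exact (h.planCost_rotation hd).trans_le (h.le_planCost hd hJ hσ)

theorem transportCost_eq (h : StandardPosition d α ψ φ V) (hd : 2 ≤ d) :
    transportCost (unitaryInvariantCostMatrix _) (ketbra ψ) (ketbra φ) =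
      (1 - α) * (d + 2 * α) :=
  (h.isOptimalChannel hd).transportCost_eq.trans (h.planCost_rotation hd)

theorem eq_conjugation_of_isOptimalChannel (h : StandardPosition d α ψ φ V) (hd : 2 ≤ d)
    (hα : 0 < α) {E : Matrix (Fin 2 ⊕ Fin (d - 2)) (Fin 2 ⊕ Fin (d - 2)) ℂ →ₗ[ℂ]
      Matrix (Fin 2 ⊕ Fin (d - 2)) (Fin 2 ⊕ Fin (d - 2)) ℂ}
    (hE : IsOptimalChannel (unitaryInvariantCostMatrix _) (ketbra ψ) (ketbra φ) E) :
    E = conjugation (Vᴴ * rotationUnitary d α * V) := by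
  refine jamiolkowski_injective (h.eq_jamiolkowski_of_planCost_le hd hα hE.1 ?_ ?_)
  · rw [partialTraceA_extendA_mul_jamiolkowski, hE.2.1]
  · rw [← hE.transportCost_eq, h.transportCost_eq hd]

theorem one {d : ℕ} {α : ℝ} (hα0 : 0 ≤ α) (hα1 : α ≤ 1) :
    StandardPosition d α (ketZero d) (ketAngle d α) 1 :=
  ⟨hα0, hα1, one_mem _, one_mulVec _, one_mulVec _⟩

end StandardPosition

end StandardPosition

section Existence

open scoped InnerProductSpace

variable {𝕜 E : Type*} [RCLike 𝕜] [NormedAddCommGroup E] [InnerProductSpace 𝕜 E]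

theorem exists_norm_eq_one_and_eq_norm_smul [Nontrivial E] (w : E) :
    ∃ χ : E, ‖χ‖ = 1 ∧ w = (‖w‖ : 𝕜) • χ := by
  rcases eq_or_ne w 0 with rfl | hw
  · obtain ⟨v, hv⟩ := exists_ne (0 : E)
    exact ⟨(‖v‖⁻¹ : 𝕜) • v, norm_smul_inv_norm hv, by simp⟩
  · exact ⟨(‖w‖⁻¹ : 𝕜) • w, norm_smul_inv_norm hw, by
      rw [smul_smul, mul_inv_cancel₀ (by simpa using hw), one_smul]⟩

theorem exists_orthogonal_unit_decomposition
    (hE : 1 < Module.finrank 𝕜 E) {ψ φ : E} (hψ : ‖ψ‖ = 1) (hφ : ‖φ‖ = 1) :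
    ∃ χ : E, ‖χ‖ = 1 ∧ ⟪ψ, χ⟫_𝕜 = 0 ∧
      φ = ⟪ψ, φ⟫_𝕜 • ψ + (√(1 - ‖⟪ψ, φ⟫_𝕜‖ ^ 2) : 𝕜) • χ := by
  have := Module.finite_of_finrank_pos (zero_lt_one.trans hE)
  have hperp : ⟪ψ, φ - ⟪ψ, φ⟫_𝕜 • ψ⟫_𝕜 = 0 := by
    rw [inner_sub_right, inner_smul_right, inner_self_eq_norm_sq_to_K, hψ]
    simp
  have hnorm : ‖φ - ⟪ψ, φ⟫_𝕜 • ψ‖ = √(1 - ‖⟪ψ, φ⟫_𝕜‖ ^ 2) := by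
    have h := norm_add_sq_eq_norm_sq_add_norm_sq_of_inner_eq_zero (𝕜 := 𝕜) (⟪ψ, φ⟫_𝕜 • ψ)
      (φ - ⟪ψ, φ⟫_𝕜 • ψ) (by rw [inner_smul_left, hperp, mul_zero])
    rw [add_sub_cancel, hφ, norm_smul, hψ] at h
    exact (Real.sqrt_sq (norm_nonneg _)).symm.trans
      (congrArg Real.sqrt (by linear_combination -h))
  have : Nontrivial (𝕜 ∙ ψ)ᗮ := by
    have hadd := (𝕜 ∙ ψ).finrank_add_finrank_orthogonal
    rw [finrank_span_singleton (norm_ne_zero_iff.1 (hψ ▸ one_ne_zero))] at hadd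
    exact Module.nontrivial_of_finrank_pos (R := 𝕜) (by omega)
  obtain ⟨χ, hχ, hw⟩ := exists_norm_eq_one_and_eq_norm_smul (𝕜 := 𝕜)
    (⟨_, Submodule.mem_orthogonal_singleton_iff_inner_right.2 hperp⟩ : (𝕜 ∙ ψ)ᗮ)
  refine ⟨χ, hχ, Submodule.mem_orthogonal_singleton_iff_inner_right.1 χ.2, ?_⟩
  rw [← hnorm, ← sub_eq_iff_eq_add']
  exact congrArg Subtype.val hw

theorem exists_orthonormalBasis_extension_inl [FiniteDimensional 𝕜 E] {ι κ : Type*} [Fintype ι]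
    [Fintype κ] {u : ι → E} (hu : Orthonormal 𝕜 u)
    (hcard : Module.finrank 𝕜 E = Fintype.card (ι ⊕ κ)) :
    ∃ b : OrthonormalBasis (ι ⊕ κ) 𝕜 E, ∀ i, b (Sum.inl i) = u i := by
  have hrestrict : Orthonormal 𝕜
      ((Set.range (Sum.inl : ι → ι ⊕ κ)).domRestrict (Sum.elim u 0)) := by
    convert hu.comp _ (Equiv.ofInjective _ (Sum.inl_injective (β := κ))).symm.injective
    ext ⟨_, i, rfl⟩
    simp
  obtain ⟨b, hb⟩ := hrestrict.exists_orthonormalBasis_extension_of_card_eq hcard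
  exact ⟨b, fun i => hb _ ⟨i, rfl⟩⟩

theorem exists_unitary_mulVec_eq_single {n : Type*} [Fintype n] [DecidableEq n]
    (b : OrthonormalBasis n 𝕜 (EuclideanSpace 𝕜 n)) :
    ∃ V ∈ unitaryGroup n 𝕜, ∀ j, V *ᵥ (b j).ofLp = Pi.single j 1 := by
  have hb : ∀ i j, (b j).ofLp ⬝ᵥ star (b i).ofLp = if i = j then 1 else 0 := fun i j =>
    orthonormal_iff_ite.1 b.orthonormal i j
  refine ⟨of fun i j => star ((b i).ofLp j), ?_, fun j => ?_⟩
  · rw [mem_unitaryGroup_iff]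
    ext i j
    rw [one_apply, ← hb i j, dotProduct_comm]
    simp [mul_apply, dotProduct, star_eq_conjTranspose]
  · ext i
    rw [Pi.single_apply, ← hb i j, dotProduct_comm]
    rfl

theorem norm_toLp_eq_one {n : Type*} [Fintype n] {v : n → ℂ} (hv : star v ⬝ᵥ v = 1) :
    ‖WithLp.toLp 2 v‖ = 1 := by
  rw [norm_eq_sqrt_re_inner (𝕜 := ℂ), EuclideanSpace.inner_toLp_toLp, dotProduct_comm, hv]
  simp

theorem exists_standardPosition (d : ℕ) {ψ φ : Fin 2 ⊕ Fin (d - 2) → ℂ}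
    (hψ : star ψ ⬝ᵥ ψ = 1) (hφ : star φ ⬝ᵥ φ = 1) :
    ∃ c : ℂ, ‖c‖ = 1 ∧ ∃ V, StandardPosition d ‖star ψ ⬝ᵥ φ‖ ψ (c • φ) V := by
  obtain ⟨c, hc, hcα⟩ := Complex.exists_norm_eq_mul_self (star ψ ⬝ᵥ φ)
  have hψ1 := norm_toLp_eq_one hψ
  have hφ1 : ‖WithLp.toLp 2 (c • φ)‖ = 1 := by
    rw [WithLp.toLp_smul, norm_smul, hc, norm_toLp_eq_one hφ, one_mul]
  have hinner : ⟪WithLp.toLp 2 ψ, WithLp.toLp 2 (c • φ)⟫_ℂ = ‖star ψ ⬝ᵥ φ‖ := by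
    rw [EuclideanSpace.inner_toLp_toLp, dotProduct_comm, dotProduct_smul, smul_eq_mul,
      hcα]
  have hle : ‖star ψ ⬝ᵥ φ‖ ≤ 1 := by
    have h := norm_inner_le_norm (𝕜 := ℂ) (WithLp.toLp 2 ψ) (WithLp.toLp 2 (c • φ))
    rwa [hinner, hψ1, hφ1, one_mul, Complex.norm_real, norm_norm] at h
  have hrank : Module.finrank ℂ (EuclideanSpace ℂ (Fin 2 ⊕ Fin (d - 2))) =
    Fintype.card (Fin 2 ⊕ Fin (d - 2)) := finrank_euclideanSpace
  obtain ⟨χ, hχ, hψχ, hφχ⟩ := exists_orthogonal_unit_decomposition (𝕜 := ℂ)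
    (by rw [hrank, Fintype.card_sum, Fintype.card_fin]; omega) hψ1 hφ1
  have hpair : Orthonormal ℂ ![WithLp.toLp 2 ψ, χ] := by
    simp [orthonormal_vecCons_iff, hψ1, hχ, hψχ]
  obtain ⟨b, hb⟩ := exists_orthonormalBasis_extension_inl hpair hrank
  obtain ⟨V, hV, hVb⟩ := exists_unitary_mulVec_eq_single b
  have hVψ : V *ᵥ ψ = Pi.single (Sum.inl 0) 1 := by simpa [hb] using hVb (Sum.inl 0)
  have hVχ : V *ᵥ χ.ofLp = Pi.single (Sum.inl 1) 1 := by simpa [hb] using hVb (Sum.inl 1)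
  refine ⟨c, hc, V, norm_nonneg _, hle, hV, hVψ.trans (ketZero_eq_single d).symm, ?_⟩
  have hφ' : c • φ = (‖star ψ ⬝ᵥ φ‖ : ℂ) • ψ + (√(1 - ‖star ψ ⬝ᵥ φ‖ ^ 2) : ℂ) • χ.ofLp := by
    rw [hinner, Complex.norm_real, norm_norm] at hφχ
    exact congrArg WithLp.ofLp hφχ
  rw [hφ', mulVec_add, mulVec_smul, mulVec_smul, hVψ, hVχ, ketAngle_eq_add]

end Existence

theorem mainTheorem4 (d : ℕ) (hd : 2 ≤ d) :
    -- the two states in the standard position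
    (∀ α : ℝ, 0 ≤ α → α ≤ 1 →
      transportCost (unitaryInvariantCostMatrix (Fin 2 ⊕ Fin (d - 2)))
          (ketbra (ketZero d)) (ketbra (ketAngle d α)) = (1 - α) * (d + 2 * α) ∧
      IsOptimalChannel (unitaryInvariantCostMatrix (Fin 2 ⊕ Fin (d - 2)))
          (ketbra (ketZero d)) (ketbra (ketAngle d α)) (conjugation (rotationUnitary d α)) ∧
      (0 < α → ∀ E : Matrix (Fin 2 ⊕ Fin (d - 2)) (Fin 2 ⊕ Fin (d - 2)) ℂ →ₗ[ℂ]
            Matrix (Fin 2 ⊕ Fin (d - 2)) (Fin 2 ⊕ Fin (d - 2)) ℂ,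
          IsOptimalChannel (unitaryInvariantCostMatrix (Fin 2 ⊕ Fin (d - 2)))
            (ketbra (ketZero d)) (ketbra (ketAngle d α)) E →
          E = conjugation (rotationUnitary d α))) ∧
    -- two arbitrary pure states, with their reduction to the standard position
    (∀ ψ φ : Fin 2 ⊕ Fin (d - 2) → ℂ, star ψ ⬝ᵥ ψ = 1 → star φ ⬝ᵥ φ = 1 →
      ∀ α : ℝ, α = ‖star ψ ⬝ᵥ φ‖ →
      transportCost (unitaryInvariantCostMatrix (Fin 2 ⊕ Fin (d - 2)))
          (ketbra ψ) (ketbra φ) = (1 - α) * (d + 2 * α) ∧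
      ∃ V ∈ Matrix.unitaryGroup (Fin 2 ⊕ Fin (d - 2)) ℂ,
        V * ketbra ψ * Vᴴ = ketbra (ketZero d) ∧
        V * ketbra φ * Vᴴ = ketbra (ketAngle d α) ∧
        IsOptimalChannel (unitaryInvariantCostMatrix (Fin 2 ⊕ Fin (d - 2)))
          (ketbra ψ) (ketbra φ) (conjugation (Vᴴ * rotationUnitary d α * V))) := by
  refine ⟨fun α hα0 hα1 => ?_, fun ψ φ hψ hφ α hα => ?_⟩
  · have h := StandardPosition.one (d := d) hα0 hα1
    have hconj : (1 : Matrix _ _ ℂ)ᴴ * rotationUnitary d α * 1 = rotationUnitary d α := by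
      rw [conjTranspose_one, one_mul, mul_one]
    exact ⟨h.transportCost_eq hd, hconj ▸ h.isOptimalChannel hd, fun hpos E hE =>
      hconj ▸ h.eq_conjugation_of_isOptimalChannel hd hpos hE⟩
  · subst hα
    obtain ⟨c, hc, V, h⟩ := exists_standardPosition d hψ hφ
    rw [← ketbra_smul hc φ]
    refine ⟨h.transportCost_eq hd, V, h.mem_unitaryGroup, ?_, ?_, h.isOptimalChannel hd⟩
    · rw [mul_ketbra_mul_conjTranspose, h.mulVec_left]
    · rw [mul_ketbra_mul_conjTranspose, h.mulVec_right]
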